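/- Let $q$ and $z$ be complex numbers with $|q|<1$ and $1+zq^{k}\neq 0$ for every integer $k\ge 1$. Write $(x;q)_\infty=\prod_{k\ge 0}(1-xq^k)$, $(x;q)_n=\prod_{k=0}^{n-1}(1-xq^k)$ and $(x,y;q)_n=(x;q)_n(y;q)_n$ for integers $n\ge 0$, and let $$\theta(x;q)=\sum_{n=0}^{\infty}(-1)^n q^{n(n-1)/2}x^n$$ be the partial theta function. Then both series over $n$ below converge absolutely, and $$\frac{(zq;q)_\infty}{(-zq;q)_\infty}+\sum_{n=0}^{\infty}\frac{(-1,z;q)_n}{(q,-zq;q)_n}(-z)^n q^{n^2+n} =\sum_{n=0}^{\infty}\frac{(-1,z;q)_n}{(q,-zq;q)_n}\bigl(1+q^n+zq^n-zq^{2n}\bigr)(-z)^n q^{n^2}\,\theta(z^2q^{2n+1};q^2).$$ -/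

import Mathlib

/-- The finite `q`-shifted factorial `(z;q)_n = ∏_{k=0}^{n-1} (1 - z q^k)`, for `n ≥ 0`. -/
def qShift (z q : ℂ) (n : ℕ) : ℂ := ∏ k ∈ Finset.range n, (1 - z * q ^ k)

/-- The infinite `q`-shifted factorial `(z;q)_∞ = ∏_{k ≥ 0} (1 - z q^k)`, for `|q| < 1`. -/
noncomputable def qShiftInf (z q : ℂ) : ℂ := ∏' k : ℕ, (1 - z * q ^ k)

/-- The partial theta function `θ(z;q) = ∑_{n ≥ 0} (-1)^n q^{n(n-1)/2} z^n`, for `|q| < 1`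
(the natural-number division is exact). -/
noncomputable def partialTheta (z q : ℂ) : ℂ :=
  ∑' n : ℕ, (-1 : ℂ) ^ n * q ^ (n * (n - 1) / 2) * z ^ n

/-- The infinite product defining `(z;q)_∞` converges. -/
theorem multipliable_qShiftInf (z q : ℂ) (hq : ‖q‖ < 1) :
    Multipliable (fun k : ℕ => 1 - z * q ^ k) := by
  have h : Summable (fun k : ℕ => ‖-(z * q ^ k)‖) := by
    simp only [norm_neg, norm_mul, norm_pow]
    exact (summable_geometric_of_lt_one (norm_nonneg q) hq).mul_left _
  simpa [sub_eq_add_neg] using multipliable_one_add_of_summable h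

/-- `(z;q)_n (z q^n;q)_∞ = (z;q)_∞`: the finite product agrees with the definition of `(z;q)_n`
as a quotient of infinite products. -/
theorem qShift_mul_qShiftInf (z q : ℂ) (hq : ‖q‖ < 1) (n : ℕ) :
    qShift z q n * qShiftInf (z * q ^ n) q = qShiftInf z q := by
  have h : Multipliable (fun k : ℕ => 1 - z * q ^ (k + n)) := by
    have := multipliable_qShiftInf (z * q ^ n) q hq
    refine this.congr fun k => ?_
    ring
  have h2 := Multipliable.prod_mul_tprod_nat_mul' (f := fun k : ℕ => 1 - z * q ^ k) h
  unfold qShift qShiftInf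
  rw [← h2]
  congr 1
  refine tprod_congr fun k => ?_
  ring

/-- The series defining `θ(z;q)` converges absolutely. -/
theorem summable_partialTheta (z q : ℂ) (hq : ‖q‖ < 1) :
    Summable (fun n : ℕ => (-1 : ℂ) ^ n * q ^ (n * (n - 1) / 2) * z ^ n) := by
  have hlim : Filter.Tendsto (fun n : ℕ => ‖q‖ ^ n * ‖z‖) Filter.atTop (nhds 0) := by
    simpa using (tendsto_pow_atTop_nhds_zero_of_lt_one (norm_nonneg q) hq).mul_const ‖z‖
  refine summable_of_ratio_norm_eventually_le (r := 1 / 2) (by norm_num) ?_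
  filter_upwards [hlim.eventually_le_const (show (0 : ℝ) < 1 / 2 by norm_num)] with n hn
  have he : (n + 1) * (n + 1 - 1) / 2 = n * (n - 1) / 2 + n := by
    rw [← Finset.sum_range_id, ← Finset.sum_range_id, Finset.sum_range_succ]
  rw [he, pow_succ z n, pow_add q]
  simp only [norm_mul, norm_pow, norm_neg, norm_one, one_pow, one_mul]
  calc _ = (‖q‖ ^ n * ‖z‖) * (‖q‖ ^ (n * (n - 1) / 2) * ‖z‖ ^ n) := by ring
    _ ≤ _ := by gcongr

/-!
The difference `F(z) = ∑ₙ cₙ ((1 + qⁿ + z qⁿ - z q²ⁿ) θₙ - qⁿ)` of the two series, with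
`cₙ = (-1,z;q)ₙ / (q,-zq;q)ₙ (-z)ⁿ q^(n²)` and `θₙ = θ(z² q^(2n+1); q²)`, satisfies the same
first-order `q`-difference equation as the quotient of infinite products,
`(1 + zq) F(z) = (1 - zq) F(zq)`.

Since `θₙ = 1 - z² q^(2n+1) θₙ₊₁` and the shift `z ↦ zq` turns `θₙ` into `θₙ₊₁`, the `n`-th term of
`(1 + zq) F(z) - (1 - zq) F(zq)` is a hypergeometric term times an affine function of `θₙ₊₁`.
It is the difference of consecutive values of an explicit `certificate` of the same kind
(`certificate_succ`), and the certificate tends to `0`, whence `seriesDiff_functional_equation`.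

Iterating gives `(-zq;q)_N F(z) = (zq;q)_N F(z q^N)` (`qShift_mul_seriesDiff`). The terms of
`F(z q^N)` are dominated, uniformly in `N`, by a constant multiple of `‖z‖ⁿ ‖q‖^(n²)`, so
`F(z q^N)` tends to `F(0) = 1` (`tendsto_seriesDiff`), and letting `N → ∞` proves the identity
(`seriesDiff_eq`). The same bounds give the absolute convergence of both series.
-/

open Filter Topology

/-! ### The `q`-shifted factorials -/

theorem qShift_succ (x q : ℂ) (n : ℕ) : qShift x q (n + 1) = qShift x q n * (1 - x * q ^ n) :=
  Finset.prod_range_succ _ _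

theorem qShift_succ' (x q : ℂ) (n : ℕ) :
    qShift x q (n + 1) = (1 - x) * qShift (x * q) q n := by
  simp only [qShift, Finset.prod_range_succ', pow_zero, mul_one]
  rw [mul_comm]
  congr 1
  exact Finset.prod_congr rfl fun k _ => by ring

theorem qShift_add (x q : ℂ) (m n : ℕ) :
    qShift x q (m + n) = qShift x q m * qShift (x * q ^ m) q n := by
  simp only [qShift, Finset.prod_range_add]
  congr 1
  exact Finset.prod_congr rfl fun k _ => by ring

theorem qShift_ne_zero {x q : ℂ} (h : ∀ k : ℕ, 1 - x * q ^ k ≠ 0) (n : ℕ) :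
    qShift x q n ≠ 0 :=
  Finset.prod_ne_zero_iff.2 fun k _ => h k

theorem one_sub_self_mul_pow_ne_zero {q : ℂ} (hq : ‖q‖ < 1) (k : ℕ) : 1 - q * q ^ k ≠ 0 := by
  intro h
  have h1 : ‖q ^ (k + 1)‖ = 1 := by
    rw [pow_succ', ← sub_eq_zero.1 h, norm_one]
  rw [norm_pow] at h1
  exact absurd h1 (pow_lt_one₀ (norm_nonneg q) hq k.succ_ne_zero).ne

theorem tendsto_qShift (x : ℂ) {q : ℂ} (hq : ‖q‖ < 1) :
    Tendsto (qShift x q) atTop (𝓝 (qShiftInf x q)) :=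
  (multipliable_qShiftInf x q hq).tendsto_prod_tprod_nat

theorem qShiftInf_ne_zero {x q : ℂ} (hq : ‖q‖ < 1) (h : ∀ k : ℕ, 1 - x * q ^ k ≠ 0) :
    qShiftInf x q ≠ 0 := by
  have hs : Summable (fun k : ℕ => ‖-(x * q ^ k)‖) := by
    simp only [norm_neg, norm_mul, norm_pow]
    exact (summable_geometric_of_lt_one (norm_nonneg q) hq).mul_left _
  have := tprod_one_add_ne_zero_of_summable (f := fun k : ℕ => -(x * q ^ k))
    (fun k => by simpa [sub_eq_add_neg] using h k) hs
  simpa [qShiftInf, sub_eq_add_neg] using this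

/-! ### Uniform bounds for the `q`-shifted factorials -/

theorem exists_norm_qShift_le {q : ℂ} (hq : ‖q‖ < 1) (R : ℝ) :
    ∃ B : ℝ, 0 ≤ B ∧ ∀ x : ℂ, ‖x‖ ≤ R → ∀ n, ‖qShift x q n‖ ≤ B := by
  refine ⟨Real.exp (R * ∑' k : ℕ, ‖q‖ ^ k), (Real.exp_pos _).le, fun x hx n => ?_⟩
  have hR : 0 ≤ R := (norm_nonneg x).trans hx
  have hs := summable_geometric_of_lt_one (norm_nonneg q) hq
  calc ‖qShift x q n‖ ≤ ∏ k ∈ Finset.range n, (1 + R * ‖q‖ ^ k) := by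
        rw [qShift, norm_prod]
        refine Finset.prod_le_prod (fun _ _ => norm_nonneg _) fun k _ => ?_
        refine (norm_sub_le _ _).trans ?_
        rw [norm_one, norm_mul, norm_pow]
        gcongr
    _ ≤ Real.exp (∑ k ∈ Finset.range n, R * ‖q‖ ^ k) :=
        Real.prod_one_add_le_exp_sum _ fun k => by positivity
    _ ≤ _ := by
        rw [← Finset.mul_sum]
        gcongr
        exact hs.sum_le_tsum _ fun k _ => by positivity

/-- The bound is uniform in the shift `N`, because `(x q^N;q)_n = (x;q)_{N+n} / (x;q)_N` and the
nonvanishing sequence `(x;q)_m` has a nonzero limit. -/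
theorem exists_norm_inv_qShift_le {x q : ℂ} (hq : ‖q‖ < 1) (h : ∀ k : ℕ, 1 - x * q ^ k ≠ 0) :
    ∃ B : ℝ, 0 ≤ B ∧ ∀ N n, ‖(qShift (x * q ^ N) q n)⁻¹‖ ≤ B := by
  obtain ⟨B₁, hB₁, h₁⟩ := exists_norm_qShift_le hq ‖x‖
  obtain ⟨B₂, h₂⟩ : ∃ B₂ : ℝ, ∀ n, ‖(qShift x q n)⁻¹‖ ≤ B₂ := by
    have := ((tendsto_qShift x hq).inv₀ (qShiftInf_ne_zero hq h)).norm.bddAbove_range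
    obtain ⟨B, hB⟩ := this
    exact ⟨B, fun n => hB ⟨n, rfl⟩⟩
  have hB₂ : 0 ≤ B₂ := (norm_nonneg _).trans (h₂ 0)
  refine ⟨B₁ * B₂, by positivity, fun N n => ?_⟩
  have hN := qShift_ne_zero h N
  have e : (qShift (x * q ^ N) q n)⁻¹ = qShift x q N * (qShift x q (N + n))⁻¹ := by
    rw [qShift_add, mul_inv, mul_inv_cancel_left₀ hN]
  rw [e, norm_mul]
  exact mul_le_mul (h₁ x le_rfl N) (h₂ _) (norm_nonneg _) hB₁

/-! ### The partial theta function -/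

theorem norm_sq_lt_one {q : ℂ} (hq : ‖q‖ < 1) : ‖q ^ 2‖ < 1 := by
  rw [norm_pow]
  exact pow_lt_one₀ (norm_nonneg q) hq two_ne_zero

theorem sq_pow_choose_two (q : ℂ) (n : ℕ) : (q ^ 2) ^ (n * (n - 1) / 2) = q ^ (n * (n - 1)) := by
  rw [← pow_mul, Nat.mul_div_cancel' (Nat.even_mul_pred_self n).two_dvd]

theorem exists_norm_partialTheta_le {q : ℂ} (hq : ‖q‖ < 1) (R : ℝ) :
    ∃ B : ℝ, 0 ≤ B ∧ ∀ x : ℂ, ‖x‖ ≤ R → ‖partialTheta x q‖ ≤ B := by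
  have hs := (summable_partialTheta (R : ℂ) q hq).norm
  refine ⟨∑' n : ℕ, ‖(-1 : ℂ) ^ n * q ^ (n * (n - 1) / 2) * (R : ℂ) ^ n‖,
    tsum_nonneg fun n => norm_nonneg _, fun x hx => ?_⟩
  refine tsum_of_norm_bounded hs.hasSum fun n => ?_
  have : ‖x‖ ≤ ‖(R : ℂ)‖ := by
    rw [Complex.norm_real]
    exact hx.trans (le_abs_self R)
  simp only [norm_mul, norm_pow]
  gcongr

theorem summable_pow_mul_pow_sq {q : ℂ} (hq : ‖q‖ < 1) (z : ℂ) :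
    Summable (fun n : ℕ => ‖z‖ ^ n * ‖q‖ ^ (n ^ 2)) := by
  refine (summable_partialTheta (z * q) (q ^ 2) (norm_sq_lt_one hq)).norm.congr fun n => ?_
  rw [sq_pow_choose_two]
  simp only [norm_mul, norm_pow, norm_neg, norm_one, one_pow, one_mul, mul_pow]
  have : n ^ 2 = n * (n - 1) + n := by
    cases n with
    | zero => rfl
    | succ n => simp only [Nat.add_sub_cancel]; ring
  rw [this, pow_add]
  ring

/-- The first-order recurrence of the partial theta function in its argument. -/
theorem partialTheta_eq_one_sub (x : ℂ) {q : ℂ} (hq : ‖q‖ < 1) :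
    partialTheta x q = 1 - x * partialTheta (x * q) q := by
  rw [partialTheta, (summable_partialTheta x q hq).tsum_eq_zero_add, partialTheta,
    ← tsum_mul_left, sub_eq_add_neg, ← tsum_neg]
  congr 1
  · simp
  · refine tsum_congr fun n => ?_
    have he : (n + 1) * (n + 1 - 1) / 2 = n * (n - 1) / 2 + n := by
      rw [← Finset.sum_range_id, ← Finset.sum_range_id, Finset.sum_range_succ]
    rw [he]
    ring

/-! ### The two series -/

/-- The coefficient `(-1,z;q)_n / (q,-zq;q)_n`. -/
noncomputable def qCoeff (z q : ℂ) (n : ℕ) : ℂ :=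
  qShift (-1) q n * qShift z q n / (qShift q q n * qShift (-z * q) q n)

/-- The general term of the series without partial theta functions. -/
noncomputable def plainTerm (z q : ℂ) (n : ℕ) : ℂ :=
  qCoeff z q n * (-z) ^ n * q ^ (n ^ 2 + n)

/-- The general term of the series of partial theta functions. -/
noncomputable def thetaTerm (z q : ℂ) (n : ℕ) : ℂ :=
  qCoeff z q n * (1 + q ^ n + z * q ^ n - z * q ^ (2 * n)) * (-z) ^ n * q ^ (n ^ 2)
    * partialTheta (z ^ 2 * q ^ (2 * n + 1)) (q ^ 2)

theorem one_sub_neg_mul_pow_ne_zero {q z : ℂ} (hz : ∀ k : ℕ, 1 + z * q ^ (k + 1) ≠ 0) (k : ℕ) :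
    1 - -z * q * q ^ k ≠ 0 := by
  convert hz k using 1
  ring

theorem norm_mul_pow_le (z : ℂ) {q : ℂ} (hq : ‖q‖ < 1) (N : ℕ) : ‖z * q ^ N‖ ≤ ‖z‖ := by
  rw [norm_mul, norm_pow]
  exact mul_le_of_le_one_right (norm_nonneg z) (pow_le_one₀ (norm_nonneg q) hq.le)

theorem exists_norm_qCoeff_le {q z : ℂ} (hq : ‖q‖ < 1) (hz : ∀ k : ℕ, 1 + z * q ^ (k + 1) ≠ 0) :
    ∃ B : ℝ, 0 ≤ B ∧ ∀ N n, ‖qCoeff (z * q ^ N) q n‖ ≤ B := by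
  obtain ⟨B₁, hB₁, h₁⟩ := exists_norm_qShift_le hq ‖(-1 : ℂ)‖
  obtain ⟨B₂, hB₂, h₂⟩ := exists_norm_qShift_le hq ‖z‖
  obtain ⟨B₃, hB₃, h₃⟩ := exists_norm_inv_qShift_le hq (one_sub_self_mul_pow_ne_zero hq)
  obtain ⟨B₄, hB₄, h₄⟩ := exists_norm_inv_qShift_le hq (one_sub_neg_mul_pow_ne_zero hz)
  refine ⟨B₁ * B₂ * (B₃ * B₄), by positivity, fun N n => ?_⟩
  have e : -(z * q ^ N) * q = -z * q * q ^ N := by ring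
  have h3 := h₃ 0 n
  rw [pow_zero, mul_one] at h3
  rw [qCoeff, div_eq_mul_inv, mul_inv, e, norm_mul, norm_mul, norm_mul]
  gcongr
  · exact h₁ _ le_rfl n
  · exact h₂ _ (norm_mul_pow_le z hq N) n
  · exact h₄ N n

theorem norm_sq_mul_pow_le {q z w : ℂ} (hq : ‖q‖ < 1) (hw : ‖w‖ ≤ ‖z‖) (k : ℕ) :
    ‖w ^ 2 * q ^ k‖ ≤ ‖z‖ ^ 2 := by
  refine (norm_mul_pow_le (w ^ 2) hq k).trans ?_
  rw [norm_pow]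
  gcongr

theorem exists_norm_plainTerm_le {q z : ℂ} (hq : ‖q‖ < 1)
    (hz : ∀ k : ℕ, 1 + z * q ^ (k + 1) ≠ 0) :
    ∃ B : ℝ, 0 ≤ B ∧
      ∀ N n, ‖plainTerm (z * q ^ N) q n‖ ≤ B * (‖z * q ^ N‖ ^ n * ‖q‖ ^ (n ^ 2)) := by
  obtain ⟨B, hB, h⟩ := exists_norm_qCoeff_le hq hz
  refine ⟨B, hB, fun N n => ?_⟩
  rw [plainTerm, norm_mul, norm_mul, norm_pow (-(z * q ^ N)), norm_neg, norm_pow q, mul_assoc]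
  refine mul_le_mul (h N n) ?_ (by positivity) hB
  exact mul_le_mul_of_nonneg_left
    (pow_le_pow_of_le_one (norm_nonneg q) hq.le (Nat.le_add_right _ _)) (by positivity)

theorem exists_norm_thetaTerm_le {q z : ℂ} (hq : ‖q‖ < 1)
    (hz : ∀ k : ℕ, 1 + z * q ^ (k + 1) ≠ 0) :
    ∃ B : ℝ, 0 ≤ B ∧
      ∀ N n, ‖thetaTerm (z * q ^ N) q n‖ ≤ B * (‖z * q ^ N‖ ^ n * ‖q‖ ^ (n ^ 2)) := by
  obtain ⟨B, hB, h⟩ := exists_norm_qCoeff_le hq hz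
  obtain ⟨T, hT, hT'⟩ := exists_norm_partialTheta_le (norm_sq_lt_one hq) (‖z‖ ^ 2)
  refine ⟨B * (1 + 1 + ‖z‖ + ‖z‖) * T, by positivity, fun N n => ?_⟩
  have hw := norm_mul_pow_le z hq N
  have hT2 := hT' _ (norm_sq_mul_pow_le hq hw (2 * n + 1))
  have hC := h N n
  rw [thetaTerm]
  generalize z * q ^ N = w at *
  have hp : ‖1 + q ^ n + w * q ^ n - w * q ^ (2 * n)‖ ≤ 1 + 1 + ‖z‖ + ‖z‖ := by
    refine (norm_sub_le _ _).trans (add_le_add ((norm_add_le _ _).trans (add_le_add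
      ((norm_add_le _ _).trans (add_le_add norm_one.le ?_)) ?_)) ?_)
    · rw [norm_pow]
      exact pow_le_one₀ (norm_nonneg q) hq.le
    · exact (norm_mul_pow_le w hq _).trans hw
    · exact (norm_mul_pow_le w hq _).trans hw
  simp only [norm_mul, norm_pow (-w), norm_neg, norm_pow q (n ^ 2)]
  calc _ = ‖qCoeff w q n‖ * ‖1 + q ^ n + w * q ^ n - w * q ^ (2 * n)‖
          * ‖partialTheta (w ^ 2 * q ^ (2 * n + 1)) (q ^ 2)‖ * (‖w‖ ^ n * ‖q‖ ^ (n ^ 2)) := by ring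
    _ ≤ _ := by gcongr

theorem summable_plainTerm {q z : ℂ} (hq : ‖q‖ < 1) (hz : ∀ k : ℕ, 1 + z * q ^ (k + 1) ≠ 0) :
    Summable (plainTerm z q) := by
  obtain ⟨B, -, h⟩ := exists_norm_plainTerm_le hq hz
  refine Summable.of_norm_bounded ((summable_pow_mul_pow_sq hq z).mul_left B) fun n => ?_
  simpa using h 0 n

theorem summable_thetaTerm {q z : ℂ} (hq : ‖q‖ < 1) (hz : ∀ k : ℕ, 1 + z * q ^ (k + 1) ≠ 0) :
    Summable (thetaTerm z q) := by
  obtain ⟨B, -, h⟩ := exists_norm_thetaTerm_le hq hz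
  refine Summable.of_norm_bounded ((summable_pow_mul_pow_sq hq z).mul_left B) fun n => ?_
  simpa using h 0 n

/-! ### The functional equation -/

/-- The telescoping certificate: the sum of the first `m + 1` terms of
`(1 + zq) F(z) - (1 - zq) F(zq)`, where `F` is the difference of the two series. The factors `1 - z`
and `1 + zq` are cancelled from the `q`-shifted factorials, so that `z = 1` is not exceptional. -/
noncomputable def certificate (z q : ℂ) (m : ℕ) : ℂ :=
  -(qShift (-1) q (m + 1) * qShift (z * q) q m / (qShift q q m * qShift (-z * q * q) q m))
    * (-z) ^ m * q ^ (m ^ 2 + m)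
    * ((1 - (1 - z) * z * q ^ (m + 1) + z ^ 3 * q ^ (2 * (m + 1)))
      * partialTheta (z ^ 2 * q ^ (2 * (m + 1) + 1)) (q ^ 2) - 1)

/-- The recurrence expressing `θₙ = θ(z² q^(2n+1); q²)` through `θₙ₊₁`. -/
theorem partialTheta_step (z : ℂ) {q : ℂ} (hq : ‖q‖ < 1) (n : ℕ) :
    partialTheta (z ^ 2 * q ^ (2 * n + 1)) (q ^ 2)
      = 1 - z ^ 2 * q ^ (2 * n + 1) * partialTheta (z ^ 2 * q ^ (2 * (n + 1) + 1)) (q ^ 2) := by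
  rw [partialTheta_eq_one_sub _ (norm_sq_lt_one hq)]
  congr 3
  ring

theorem certificate_zero (z : ℂ) {q : ℂ} (hq : ‖q‖ < 1) :
    (1 + z * q) * (thetaTerm z q 0 - plainTerm z q 0)
      - (1 - z * q) * (thetaTerm (z * q) q 0 - plainTerm (z * q) q 0) = certificate z q 0 := by
  have h := partialTheta_step z hq 0
  have e : (z * q) ^ 2 * q ^ (2 * 0 + 1) = z ^ 2 * q ^ (2 * (0 + 1) + 1) := by ring
  simp only [thetaTerm, plainTerm, certificate, qCoeff, e]
  rw [h]
  simp [qShift]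
  ring

theorem certificate_succ {q z : ℂ} (hq : ‖q‖ < 1) (hz : ∀ k : ℕ, 1 + z * q ^ (k + 1) ≠ 0)
    (m : ℕ) :
    (1 + z * q) * (thetaTerm z q (m + 1) - plainTerm z q (m + 1))
      - (1 - z * q) * (thetaTerm (z * q) q (m + 1) - plainTerm (z * q) q (m + 1))
      = certificate z q (m + 1) - certificate z q m := by
  have h := partialTheta_step z hq (m + 1)
  have e : (z * q) ^ 2 * q ^ (2 * (m + 1) + 1) = z ^ 2 * q ^ (2 * (m + 1 + 1) + 1) := by ring
  have e2 : -(z * q) * q = -z * q * q := by ring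
  have hc : qShift q q m ≠ 0 := qShift_ne_zero (one_sub_self_mul_pow_ne_zero hq) m
  have hc' := one_sub_self_mul_pow_ne_zero hq m
  have h0 : 1 + z * q ≠ 0 := by simpa using hz 0
  have hd' : 1 + z * q * q ^ (m + 1) ≠ 0 := by
    convert hz (m + 1) using 1
    ring
  have hd : qShift (-z * q * q) q m ≠ 0 := by
    have := qShift_ne_zero (one_sub_neg_mul_pow_ne_zero hz) (m + 1)
    rw [qShift_succ'] at this
    exact right_ne_zero_of_mul this
  simp only [thetaTerm, plainTerm, certificate, qCoeff, e, e2]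
  rw [h, qShift_succ' z, qShift_succ' (-z * q), qShift_succ (z * q), qShift_succ q,
    qShift_succ (-z * q * q), qShift_succ (-1) q (m + 1)]
  have s1 : 1 - q * q ^ m = 1 - q ^ (m + 1) := by ring
  have s2 : 1 - -z * q * q * q ^ m = 1 + z * q * q ^ (m + 1) := by ring
  have s3 : 1 - z * q * q ^ m = 1 - z * q ^ (m + 1) := by ring
  have s4 : q ^ ((m + 1) ^ 2 + (m + 1)) = q ^ (m ^ 2 + m) * (q ^ (m + 1)) ^ 2 := by ring
  have s5 : q ^ ((m + 1) ^ 2) = q ^ (m ^ 2 + m) * q ^ (m + 1) := by ring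
  have s6 : (-(z * q)) ^ (m + 1) = -z * (-z) ^ m * q ^ (m + 1) := by
    rw [← neg_mul, mul_pow, pow_succ]; ring
  have s7 : q ^ (2 * (m + 1)) = (q ^ (m + 1)) ^ 2 := by ring
  have s8 : q ^ (2 * (m + 1) + 1) = (q ^ (m + 1)) ^ 2 * q := by ring
  have s9 : q ^ (m + 1 + 1) = q ^ (m + 1) * q := by ring
  have s10 : q ^ (2 * (m + 1 + 1)) = (q ^ (m + 1)) ^ 2 * q ^ 2 := by ring
  have s11 : 1 - -z * q = 1 + z * q := by ring
  rw [s1] at hc'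
  rw [s1, s2, s3, s4, s5, s6, s7, s8, s9, s10, s11, pow_succ (-z)]
  -- Everything is now written in the factors common to the four terms, in `y = q ^ (m + 1)` and in
  -- one partial theta value `T`: what remains is an identity of rational functions.
  generalize partialTheta (z ^ 2 * q ^ (2 * (m + 1 + 1) + 1)) (q ^ 2) = T
  generalize q ^ (m ^ 2 + m) = Q at *
  generalize q ^ (m + 1) = y at *
  generalize (-z) ^ m = Z at *
  generalize qShift (-z * q * q) q m = d at *
  generalize qShift q q m = c at *
  generalize qShift (z * q) q m = b at *
  generalize qShift (-1) q (m + 1) = a at *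
  field_simp
  ring

theorem sum_range_eq_certificate {q z : ℂ} (hq : ‖q‖ < 1)
    (hz : ∀ k : ℕ, 1 + z * q ^ (k + 1) ≠ 0) (m : ℕ) :
    ∑ n ∈ Finset.range (m + 1), ((1 + z * q) * (thetaTerm z q n - plainTerm z q n)
      - (1 - z * q) * (thetaTerm (z * q) q n - plainTerm (z * q) q n)) = certificate z q m := by
  induction m with
  | zero => rw [Finset.sum_range_one, certificate_zero z hq]
  | succ m ih => rw [Finset.sum_range_succ, ih, certificate_succ hq hz]; ring

theorem tendsto_certificate {q z : ℂ} (hq : ‖q‖ < 1) (hz : ∀ k : ℕ, 1 + z * q ^ (k + 1) ≠ 0) :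
    Tendsto (certificate z q) atTop (𝓝 0) := by
  obtain ⟨B₁, hB₁, h₁⟩ := exists_norm_qShift_le hq ‖(-1 : ℂ)‖
  obtain ⟨B₂, hB₂, h₂⟩ := exists_norm_qShift_le hq ‖z * q‖
  obtain ⟨B₃, hB₃, h₃⟩ := exists_norm_inv_qShift_le hq (one_sub_self_mul_pow_ne_zero hq)
  obtain ⟨B₄, hB₄, h₄⟩ := exists_norm_inv_qShift_le hq (one_sub_neg_mul_pow_ne_zero hz)
  obtain ⟨T, hT, hT'⟩ := exists_norm_partialTheta_le (norm_sq_lt_one hq) (‖z‖ ^ 2)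
  set D : ℝ := (1 + ‖(1 - z) * z‖ + ‖z ^ 3‖) * T + 1 with hD
  have hs := ((summable_pow_mul_pow_sq hq z).mul_left
    (B₁ * B₂ * (B₃ * B₄) * D)).tendsto_atTop_zero
  refine squeeze_zero_norm (fun m => ?_) hs
  have h3 := h₃ 0 m
  rw [pow_zero, mul_one] at h3
  have h4 := h₄ 1 m
  rw [pow_one] at h4
  have hp : ‖(1 - (1 - z) * z * q ^ (m + 1) + z ^ 3 * q ^ (2 * (m + 1)))
      * partialTheta (z ^ 2 * q ^ (2 * (m + 1) + 1)) (q ^ 2) - 1‖ ≤ D := by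
    refine (norm_sub_le _ _).trans (add_le_add ?_ norm_one.le)
    rw [norm_mul]
    refine mul_le_mul ?_ (hT' _ (norm_sq_mul_pow_le hq le_rfl _)) (norm_nonneg _) (by positivity)
    exact (norm_add_le _ _).trans (add_le_add ((norm_sub_le _ _).trans (add_le_add norm_one.le
      (norm_mul_pow_le _ hq _))) (norm_mul_pow_le _ hq _))
  have hq2 : ‖q‖ ^ (m ^ 2 + m) ≤ ‖q‖ ^ (m ^ 2) :=
    pow_le_pow_of_le_one (norm_nonneg q) hq.le (Nat.le_add_right _ _)
  rw [certificate, div_eq_mul_inv, mul_inv, norm_mul, norm_mul, norm_mul, norm_neg, norm_mul,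
    norm_mul, norm_mul, norm_pow, norm_pow, norm_neg]
  calc _ ≤ B₁ * B₂ * (B₃ * B₄) * ‖z‖ ^ m * ‖q‖ ^ (m ^ 2) * D := by
        gcongr
        · exact h₁ _ le_rfl _
        · exact h₂ _ le_rfl _
    _ = _ := by ring

/-- The difference of the two series, as a function of `z`. -/
noncomputable def seriesDiff (z q : ℂ) : ℂ := ∑' n, (thetaTerm z q n - plainTerm z q n)

theorem one_add_mul_pow_shift_ne_zero {q z : ℂ} (hz : ∀ k : ℕ, 1 + z * q ^ (k + 1) ≠ 0)
    (N k : ℕ) : 1 + z * q ^ N * q ^ (k + 1) ≠ 0 := by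
  convert hz (N + k) using 1
  ring

/-- The `q`-difference equation satisfied by `(zq;q)_∞ / (-zq;q)_∞`. -/
theorem seriesDiff_functional_equation {q z : ℂ} (hq : ‖q‖ < 1)
    (hz : ∀ k : ℕ, 1 + z * q ^ (k + 1) ≠ 0) :
    (1 + z * q) * seriesDiff z q = (1 - z * q) * seriesDiff (z * q) q := by
  have hz' : ∀ k : ℕ, 1 + z * q * q ^ (k + 1) ≠ 0 := by
    simpa using one_add_mul_pow_shift_ne_zero hz 1
  have s1 := ((summable_thetaTerm hq hz).sub (summable_plainTerm hq hz)).mul_left (1 + z * q)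
  have s2 := ((summable_thetaTerm hq hz').sub (summable_plainTerm hq hz')).mul_left (1 - z * q)
  have hlim := (tendsto_add_atTop_iff_nat 1).2 (s1.sub s2).hasSum.tendsto_sum_nat
  have h0 := tendsto_nhds_unique hlim
    ((tendsto_certificate hq hz).congr fun m => (sum_range_eq_certificate hq hz m).symm)
  rw [s1.tsum_sub s2, tsum_mul_left, tsum_mul_left] at h0
  exact sub_eq_zero.1 h0

theorem qShift_mul_seriesDiff {q z : ℂ} (hq : ‖q‖ < 1)
    (hz : ∀ k : ℕ, 1 + z * q ^ (k + 1) ≠ 0) (N : ℕ) :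
    qShift (-z * q) q N * seriesDiff z q = qShift (z * q) q N * seriesDiff (z * q ^ N) q := by
  induction N with
  | zero => simp [qShift]
  | succ N ih =>
    have h := seriesDiff_functional_equation hq (one_add_mul_pow_shift_ne_zero hz N)
    have e : z * q ^ N * q = z * q ^ (N + 1) := by ring
    rw [e] at h
    rw [qShift_succ, qShift_succ]
    linear_combination (1 + z * q ^ (N + 1)) * ih + qShift (z * q) q N * h

/-! ### The limit of the iterated equation -/

theorem tendsto_seriesDiff {q z : ℂ} (hq : ‖q‖ < 1) (hz : ∀ k : ℕ, 1 + z * q ^ (k + 1) ≠ 0) :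
    Tendsto (fun N : ℕ => seriesDiff (z * q ^ N) q) atTop (𝓝 1) := by
  obtain ⟨B₁, hB₁, h₁⟩ := exists_norm_thetaTerm_le hq hz
  obtain ⟨B₂, hB₂, h₂⟩ := exists_norm_plainTerm_le hq hz
  have hb : ∀ N n, ‖thetaTerm (z * q ^ N) q n - plainTerm (z * q ^ N) q n‖
      ≤ (B₁ + B₂) * (‖z * q ^ N‖ ^ n * ‖q‖ ^ (n ^ 2)) := fun N n =>
    (norm_sub_le _ _).trans ((add_le_add (h₁ N n) (h₂ N n)).trans_eq (add_mul _ _ _).symm)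
  have hw : Tendsto (fun N : ℕ => z * q ^ N) atTop (𝓝 0) := by
    simpa using (tendsto_pow_atTop_nhds_zero_of_norm_lt_one hq).const_mul z
  have hlim : ∀ n, Tendsto (fun N => thetaTerm (z * q ^ N) q n - plainTerm (z * q ^ N) q n) atTop
      (𝓝 (if n = 0 then 1 else 0)) := by
    rintro (_ | n)
    · -- The term `n = 0` is `2 θ₀ - 1 = 1 - 2 w² q θ₁` at `w = z q ^ N`, with `θ₁` bounded.
      obtain ⟨T, hT, hT'⟩ := exists_norm_partialTheta_le (norm_sq_lt_one hq) (‖z‖ ^ 2)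
      have e : ∀ N, thetaTerm (z * q ^ N) q 0 - plainTerm (z * q ^ N) q 0
          = 1 - (z * q ^ N) ^ 2 * (2 * q
            * partialTheta ((z * q ^ N) ^ 2 * q ^ (2 * (0 + 1) + 1)) (q ^ 2)) := fun N => by
        rw [thetaTerm, plainTerm, partialTheta_step (z * q ^ N) hq 0]
        simp [qCoeff, qShift]
        ring
      have hbd : Tendsto (fun N => (z * q ^ N) ^ 2 * (2 * q
            * partialTheta ((z * q ^ N) ^ 2 * q ^ (2 * (0 + 1) + 1)) (q ^ 2))) atTop (𝓝 0) := by
        have h2 : Tendsto (fun N => ‖(z * q ^ N) ^ 2‖ * (‖2 * q‖ * T)) atTop (𝓝 0) := by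
          simpa using ((hw.pow 2).norm.mul_const (‖2 * q‖ * T))
        refine squeeze_zero_norm (fun N => ?_) h2
        rw [norm_mul, norm_mul (2 * q)]
        gcongr
        exact hT' _ (norm_sq_mul_pow_le hq (norm_mul_pow_le z hq N) _)
      simpa [e] using hbd.const_sub 1
    · have h2 : Tendsto (fun N => (B₁ + B₂) * (‖z * q ^ N‖ ^ (n + 1) * ‖q‖ ^ ((n + 1) ^ 2)))
          atTop (𝓝 0) := by
        simpa using ((hw.norm.pow (n + 1)).mul_const (‖q‖ ^ ((n + 1) ^ 2))).const_mul (B₁ + B₂)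
      simpa using squeeze_zero_norm (fun N => hb N (n + 1)) h2
  have := tendsto_tsum_of_dominated_convergence
    ((summable_pow_mul_pow_sq hq z).mul_left (B₁ + B₂)) hlim
    (Eventually.of_forall fun N n => (hb N n).trans (by
      have := norm_mul_pow_le z hq N
      gcongr))
  simpa [seriesDiff] using this

theorem seriesDiff_eq {q z : ℂ} (hq : ‖q‖ < 1) (hz : ∀ k : ℕ, 1 + z * q ^ (k + 1) ≠ 0) :
    seriesDiff z q = qShiftInf (z * q) q / qShiftInf (-z * q) q := by
  have h1 := (tendsto_qShift (-z * q) hq).mul_const (seriesDiff z q)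
  have h2 := (tendsto_qShift (z * q) hq).mul (tendsto_seriesDiff hq hz)
  have h := tendsto_nhds_unique h1 (h2.congr fun N => (qShift_mul_seriesDiff hq hz N).symm)
  rw [eq_div_iff (qShiftInf_ne_zero hq (one_sub_neg_mul_pow_ne_zero hz)), mul_comm, h, mul_one]

theorem mainTheorem4 (q z : ℂ) (hq : ‖q‖ < 1) (hz : ∀ k : ℕ, 1 + z * q ^ (k + 1) ≠ 0) :
    Summable (fun n : ℕ =>
      qShift (-1) q n * qShift z q n / (qShift q q n * qShift (-z * q) q n)
        * (-z) ^ n * q ^ (n ^ 2 + n)) ∧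
    Summable (fun n : ℕ =>
      qShift (-1) q n * qShift z q n / (qShift q q n * qShift (-z * q) q n)
        * (1 + q ^ n + z * q ^ n - z * q ^ (2 * n)) * (-z) ^ n * q ^ (n ^ 2)
        * partialTheta (z ^ 2 * q ^ (2 * n + 1)) (q ^ 2)) ∧
    qShiftInf (z * q) q / qShiftInf (-z * q) q
      + ∑' n : ℕ,
          qShift (-1) q n * qShift z q n / (qShift q q n * qShift (-z * q) q n)
            * (-z) ^ n * q ^ (n ^ 2 + n)
      = ∑' n : ℕ,
          qShift (-1) q n * qShift z q n / (qShift q q n * qShift (-z * q) q n)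
            * (1 + q ^ n + z * q ^ n - z * q ^ (2 * n)) * (-z) ^ n * q ^ (n ^ 2)
            * partialTheta (z ^ 2 * q ^ (2 * n + 1)) (q ^ 2) := by
  refine ⟨summable_plainTerm hq hz, summable_thetaTerm hq hz, ?_⟩
  change _ + ∑' n, plainTerm z q n = ∑' n, thetaTerm z q n
  rw [← seriesDiff_eq hq hz, seriesDiff,
    (summable_thetaTerm hq hz).tsum_sub (summable_plainTerm hq hz), sub_add_cancel]
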